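/- Let $m\ge 2$, $n=m+1$, and let $M=\mathbb H^m/\Gamma$ be a complete hyperbolic $m$-manifold, $\Gamma\subset \mathrm{Isom}(\mathbb H^m)$ acting freely and properly discontinuously. Via $\mathrm{Isom}(\mathbb H^m)\subset\mathrm{Isom}(\mathbb H^n)$, induced by the totally geodesic inclusion $\mathbb H^m\subset\mathbb H^n$ (hyperboloid model, $\gamma\mapsto\gamma\oplus 1$), let $X=\mathbb H^n/\Gamma\cong M\times\mathbb R$ be the associated Fuchsian manifold, where $(x,r)$ is the point at signed distance $r$ from $x\in M$ on the geodesic normal to $M$ at $x$, and let $\pi:X\to M$, $\pi(x,r)=x$, be the orthogonal projection. Let $\mathfrak g=\mathfrak{so}(1,n)$ be the Lie algebra of $\mathrm{Isom}(\mathbb H^n)$ and let $\mathcal E$ be the flat bundle $(\mathbb H^n\times\mathfrak g)/\Gamma$ over $X$ ($\Gamma$ acting by $\mathrm{Ad}$ on $\mathfrak g$), also restricted to $M=M\times\{0\}$. Smooth $\mathcal E$-valued forms are the $\Gamma$-invariant smooth $\mathfrak g$-valued forms upstairs. For a local orthonormal frame $e_j$ with dual coframe $\omega_j$, $E_j(p)\in\mathfrak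 g$ denotes the infinitesimal translation at $p$ in direction $e_j(p)$, and $R_{ij}=[E_i,E_j]$. The flat differential $d_{\mathcal E}$ differentiates coefficients with respect to constant bases of $\mathfrak g$. Its codifferential is $\delta_{\mathcal E}=D^*+T^*$, where $$D^*=-\sum_j i(e_j)\nabla_{e_j},\qquad T^*=\sum_j i(e_j)\,\mathrm{ad}(E_j);$$ here $\nabla$ is induced by the Levi-Civita connection of $\mathbb H^n$ under $\mathcal E\cong TX\oplus\mathfrak{so}(TX)$ (infinitesimal translations and rotations), and for forms on $M$ only the directions tangent to $M$ are used. A form $\omega$ is closed if $d_{\mathcal E}\omega=0$ and co-closed if $\delta_{\mathcal E}\omega=0$. Let $n$ also denote the unit normal of the slices $M\times\{r\}$ (in the direction of increasing $r$), with infinitesimal translation $N$, and let $R_{ni}=[N,E_i]$. An orthonormal frame $e_1,\dots,e_m$ of $M$ is extended to $M\times\mathbb R$ by letting $e_i$ at $(x,r)$ be $\operatorname{sech} r$ times the vector tangent to the slice that projects to $e_i(x)$ under $d\pi$; the $\omega_i$ are extended as the dual coframe, $\cosh r\;\pi^*\omega_i$. Let $B$ be a smooth, closed and co-closed $\mathcal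 E$-valued $1$-form on $M$ which in local orthonormal frames of $M$ has the form $B=\sum_{i,j=1}^m b_{ij}\,R_{ni}\otimes\omega_j$ with $(b_{ij})$ symmetric and traceless at each point. Then there is a smooth $\mathcal E$-valued $1$-form $\omega_0$ on $X=M\times\mathbb R$ which, at each $(x,r)$ and for every such expression of $B$ at $x$, is given in the extended frame by $$\omega_0=\sum_{i,j} b_{ij}(x)\,R_{ni}\otimes\omega_j-\tanh r\sum_{i,j} b_{ij}(x)\,E_i\otimes\omega_j .$$ It equals $\pi^*B$, it is closed and co-closed, and it satisfies $D^*\omega_0=0$. -/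

import Mathlib

open scoped ContDiff

noncomputable section

namespace Fuchsian

/-! ### Minkowski space, the hyperboloid and its isometries -/

/-- Minkowski space of signature `(1, n)`; coordinate `0` is the time coordinate. -/
abbrev Mink (n : ℕ) : Type := Fin (n + 1) → ℝ

/-- Linear endomorphisms of Minkowski space (with the commutator bracket). -/
abbrev EndM (n : ℕ) : Type := Mink n →L[ℝ] Mink n

/-- The Lorentz form `-x₀y₀ + x₁y₁ + ⋯ + xₙyₙ`. -/
def lor (n : ℕ) : LinearMap.BilinForm ℝ (Mink n) :=
  LinearMap.mk₂ ℝ (fun x y => -(x 0 * y 0) + ∑ i : Fin n, x i.succ * y i.succ)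
    (fun x y z => by
      simp only [Pi.add_apply, add_mul, Finset.sum_add_distrib]; ring)
    (fun c x y => by
      simp only [Pi.smul_apply, smul_eq_mul, mul_add, Finset.mul_sum, mul_assoc]; ring)
    (fun x y z => by
      simp only [Pi.add_apply, mul_add, Finset.sum_add_distrib]; ring)
    (fun c x y => by
      simp only [Pi.smul_apply, smul_eq_mul, mul_add, Finset.mul_sum, mul_left_comm _ c]; ring)

theorem lor_apply {n : ℕ} (x y : Mink n) :
    lor n x y = -(x 0 * y 0) + ∑ i : Fin n, x i.succ * y i.succ := rfl

/-- The covector `w ↦ ⟨v, w⟩`. -/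
def flat {n : ℕ} (v : Mink n) : Mink n →L[ℝ] ℝ := LinearMap.toContinuousLinearMap (lor n v)

/-- The open cone of future timelike vectors. -/
def cone (n : ℕ) : Set (Mink n) := {x | lor n x x < 0 ∧ 0 < x 0}

/-- Hyperbolic `n`-space: the upper sheet of the hyperboloid `⟨x, x⟩ = -1`. The tangent space at `p`
is the orthogonal complement of `p`, and the Riemannian metric is the restriction of the
Lorentz form. -/
abbrev Hyp (n : ℕ) : Type := {x : Mink n // lor n x x = -1 ∧ 0 < x 0}

/-- The isometry group of `Hyp n`: Lorentz transformations preserving the upper sheet. -/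
def Isom (n : ℕ) : Subgroup (Mink n ≃L[ℝ] Mink n) where
  carrier := {g | (∀ x y, lor n (g x) (g y) = lor n x y) ∧
    ∀ x, (lor n (g x) (g x) = -1 ∧ 0 < g x 0) ↔ (lor n x x = -1 ∧ 0 < x 0)}
  mul_mem' := by
    rintro a b ⟨ha, ha'⟩ ⟨hb, hb'⟩
    exact ⟨fun x y => (ha _ _).trans (hb _ _), fun x => (ha' _).trans (hb' _)⟩
  one_mem' := ⟨fun _ _ => rfl, fun _ => Iff.rfl⟩
  inv_mem' := by
    rintro a ⟨ha, ha'⟩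
    have key : ∀ x, a (a⁻¹ x) = x := fun x => a.apply_symm_apply x
    refine ⟨fun x y => ?_, fun x => ?_⟩
    · rw [← ha, key, key]
    · rw [← ha', key]

instance (n : ℕ) : MulAction (Isom n) (Hyp n) where
  smul g p := ⟨g.1 p.1, (g.2.2 p.1).2 p.2⟩
  one_smul _ := rfl
  mul_smul _ _ _ := rfl

/-- `Γ` acts freely and properly discontinuously on `Hyp n`, i.e. `Γ` is the holonomy group of the
complete hyperbolic manifold `Hyp n / Γ`. -/
structure IsManifoldGroup {n : ℕ} (Γ : Subgroup (Isom n)) : Prop where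
  properlyDiscontinuous : ProperlyDiscontinuousSMul Γ (Hyp n)
  free : ∀ γ : Γ, ∀ p : Hyp n, γ • p = p → γ = 1

/-! ### Calculus on the hyperboloid -/

theorem normalize_mem {n : ℕ} {z : Mink n} (h : z ∈ cone n) :
    lor n ((√(-lor n z z))⁻¹ • z) ((√(-lor n z z))⁻¹ • z) = -1 ∧
      0 < ((√(-lor n z z))⁻¹ • z) 0 := by
  have h1 : 0 < -lor n z z := by have := h.1; linarith
  have h2 : 0 < √(-lor n z z) := Real.sqrt_pos.2 h1
  constructor
  · simp only [map_smul, LinearMap.smul_apply, smul_eq_mul]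
    have h3 := Real.mul_self_sqrt h1.le
    field_simp
    nlinarith
  · simpa using mul_pos (inv_pos.2 h2) h.2

theorem basepoint_mem (n : ℕ) :
    lor n (Pi.single 0 1) (Pi.single 0 1) = -1 ∧ 0 < (Pi.single 0 1 : Mink n) 0 := by
  simp [lor_apply, Fin.succ_ne_zero]

open Classical in
/-- Radial retraction of the future cone onto the hyperboloid (junk value off the cone). -/
def retr {n : ℕ} (z : Mink n) : Hyp n :=
  if h : z ∈ cone n then ⟨(√(-lor n z z))⁻¹ • z, normalize_mem h⟩
  else ⟨Pi.single 0 1, basepoint_mem n⟩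

variable {F : Type*} [NormedAddCommGroup F] [NormedSpace ℝ F]

/-- A map on `Hyp n` is smooth if its radial extension to the open future cone is. -/
def SmoothOnHyp {n : ℕ} (f : Hyp n → F) : Prop :=
  ContDiffOn ℝ ∞ (fun z => f (retr z)) (cone n)

/-- The derivative of `f : Hyp n → F` at `p`; only its values at tangent vectors `v ⊥ p`
are used (there it does not depend on the extension of `f`). -/
def dHyp {n : ℕ} (f : Hyp n → F) (p : Hyp n) : Mink n →L[ℝ] F :=
  fderiv ℝ (fun z => f (retr z)) p.1

/-- Orthogonal projection of Minkowski space onto the tangent space at `p` (where `⟨p, p⟩ = -1`). -/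
def tproj {n : ℕ} (p : Mink n) : EndM n := ContinuousLinearMap.id ℝ _ + (flat p).smulRight p

/-- `e` is an orthonormal basis of the tangent space of `Hyp n` at `p`. -/
def IsFrameAt {n : ℕ} (p : Hyp n) (e : Fin n → Mink n) : Prop :=
  (∀ i, lor n p.1 (e i) = 0) ∧ ∀ i j, lor n (e i) (e j) = if i = j then 1 else 0

/-- Orthonormal bases of the tangent spaces exist. -/
theorem exists_isFrameAt {n : ℕ} (p : Hyp n) : ∃ e, IsFrameAt p e := by
  have hp : (1 + p.1 0) ≠ 0 := by have := p.2.2; positivity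
  have h00 : lor n (Pi.single 0 1) (Pi.single 0 1) = -1 := (basepoint_mem n).1
  have h0 : ∀ x : Mink n, lor n x (Pi.single 0 1) = -x 0 := fun x => by
    simp [lor_apply, Fin.succ_ne_zero]
  have h0' : ∀ x : Mink n, lor n (Pi.single 0 1) x = -x 0 := fun x => by
    simp [lor_apply, Fin.succ_ne_zero]
  have hs : ∀ (x : Mink n) (i : Fin n), lor n x (Pi.single i.succ 1) = x i.succ := fun x i => by
    simp [lor_apply, Pi.single_apply]
  have hs' : ∀ (x : Mink n) (i : Fin n), lor n (Pi.single i.succ 1) x = x i.succ := fun x i => by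
    simp [lor_apply, Pi.single_apply]
  refine ⟨fun i => Pi.single i.succ 1 + (p.1 i.succ / (1 + p.1 0)) • (Pi.single 0 1 + p.1),
    fun i => ?_, fun i j => ?_⟩
  · simp only [map_add, map_smul, hs, h0, p.2.1, smul_eq_mul]
    field_simp
    ring
  · simp only [map_add, map_smul, hs, hs', h0, h0', p.2.1, smul_eq_mul, LinearMap.add_apply,
      LinearMap.smul_apply, Pi.single_apply, Fin.succ_inj, Fin.succ_ne_zero, if_true, if_false]
    split_ifs with h h2 h2
    · field_simp
      ring
    · exact absurd h.symm h2
    · exact absurd h2.symm h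
    · field_simp
      ring

/-! ### Infinitesimal isometries

The Lie algebra of `Isom n` is the algebra of endomorphisms skew for the Lorentz form. -/

/-- The infinitesimal translation at `p` in the direction `v`: the skew endomorphism taking `p`
to `v`, taking `v` to `⟨v, v⟩ p`, and vanishing on the complement of `p, v`. -/
def transl {n : ℕ} (p v : Mink n) : EndM n := (flat v).smulRight p - (flat p).smulRight v

/-- The infinitesimal rotation at `p` in the plane of the tangent vectors `u, v`
(for `u, v` orthonormal, it takes `v` to `u`). -/
def rot {n : ℕ} (p u v : Mink n) : EndM n := ⁅transl p u, transl p v⁆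

/-! ### Forms with values in the flat bundle

The bundle over `Hyp k / Γ` has as fibre the Lie algebra of `Isom n`, on which `Γ` acts by `Ad ∘ σ`,
for a homomorphism `σ : Isom k → Isom n`. Sections and forms are the invariant ones upstairs. -/

/-- Smooth `1`-forms on `Hyp k / Γ` with values in the flat bundle: invariant `1`-forms on `Hyp k`
with values in the Lie algebra of `Isom n`. A linear map on the tangent space at `p`
is recorded as the linear map on Minkowski space that agrees with it there and vanishes at `p`. -/
structure EForm (k n : ℕ) (Γ : Subgroup (Isom k)) (σ : Isom k →* Isom n) where
  toFun : Hyp k → Mink k →L[ℝ] EndM n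
  skew' : ∀ p v, (toFun p v : Mink n →ₗ[ℝ] Mink n) ∈ skewAdjointLieSubalgebra (lor n)
  normal' : ∀ p : Hyp k, toFun p p.1 = 0
  smooth' : SmoothOnHyp toFun
  invariant' : ∀ γ ∈ Γ, ∀ p v, toFun (γ • p) (γ.1 v) =
    ((σ γ).1 : EndM n) ∘L toFun p v ∘L ((σ γ).1.symm : EndM n)

instance (k n : ℕ) (Γ : Subgroup (Isom k)) (σ : Isom k →* Isom n) :
    CoeFun (EForm k n Γ σ) (fun _ => Hyp k → Mink k →L[ℝ] EndM n) := ⟨EForm.toFun⟩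

/-- `d α = 0` for the flat differential (coefficients in a constant basis are differentiated):
`(dα)(v, w) = (D_v α)(w) - (D_w α)(v)` for tangent vectors `v, w`. -/
def IsClosedForm {k : ℕ} (α : Hyp k → Mink k →L[ℝ] F) : Prop :=
  ∀ (p : Hyp k) (v w : Mink k), lor k p.1 v = 0 → lor k p.1 w = 0 →
    dHyp α p v w - dHyp α p w v = 0

/-! In the next definitions, `ι : Mink k → Mink n` is a linear isometric embedding, by which
`Hyp k` is a totally geodesic subspace of `Hyp n`, and sections and forms over `Hyp k` have values
in the restriction to `Hyp k` of the bundle over `Hyp n`. The ambient case is `ι = id`. -/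

/-- The geometric connection. A section `V` is split at the point `q = ι p` into the tangent vector
field `u = V q` of its translational part, and the field `tproj q ∘ V ∘ tproj q` of skew endomorphisms
of the tangent space which is its rotational part; both are differentiated by the
Levi-Civita connection (differentiate in Minkowski space and project). -/
def nablaE {k n : ℕ} (ι : Mink k →L[ℝ] Mink n) (V : Hyp k → EndM n) (p : Hyp k) (v : Mink k) :
    EndM n :=
  transl (ι p.1) (tproj (ι p.1) (dHyp (fun y => V y (ι y.1)) p v)) +
    tproj (ι p.1) ∘L (dHyp (fun y => tproj (ι y.1) ∘L V y ∘L tproj (ι y.1)) p v) ∘L tproj (ι p.1)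

/-- `(∇_v α)(w) = ∇_v (α(W)) - α(∇_v W)`, where the tangent vector `w` at `p` is extended to the
tangent vector field `W = tproj · w`. -/
def nablaForm {k n : ℕ} (ι : Mink k →L[ℝ] Mink n) (α : Hyp k → Mink k →L[ℝ] EndM n) (p : Hyp k)
    (v w : Mink k) : EndM n :=
  nablaE ι (fun y => α y (tproj y.1 w)) p v -
    α p (tproj p.1 (dHyp (fun y : Hyp k => tproj y.1 w) p v))

/-- `D* α = - ∑ⱼ i(eⱼ) ∇_{eⱼ} α` at `p`, for an orthonormal frame `e` there. -/
def Dstar {k n : ℕ} (ι : Mink k →L[ℝ] Mink n) (α : Hyp k → Mink k →L[ℝ] EndM n) (p : Hyp k)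
    (e : Fin k → Mink k) : EndM n :=
  -∑ j, nablaForm ι α p (e j) (e j)

/-- `T* α = ∑ⱼ i(eⱼ) ad(Eⱼ) α` at `p`, for an orthonormal frame `e` there. -/
def Tstar {k n : ℕ} (ι : Mink k →L[ℝ] Mink n) (α : Hyp k → Mink k →L[ℝ] EndM n) (p : Hyp k)
    (e : Fin k → Mink k) : EndM n :=
  ∑ j, ⁅transl (ι p.1) (ι (e j)), α p (e j)⁆

/-- `δ α = 0` for the codifferential (the formal adjoint of the flat differential with respect to the
invariant fibre metric), which is `δ = D* + T*`. -/
def IsCoclosedForm {k n : ℕ} (ι : Mink k →L[ℝ] Mink n) (α : Hyp k → Mink k →L[ℝ] EndM n) : Prop :=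
  ∀ p e, IsFrameAt p e → Dstar ι α p e + Tstar ι α p e = 0

/-- `∑ᵢⱼ bᵢⱼ Sᵢ ⊗ θⱼ`. -/
def tensorSum {m k n : ℕ} (b : Matrix (Fin m) (Fin m) ℝ) (S : Fin m → EndM n)
    (θ : Fin m → Mink k →L[ℝ] ℝ) : Mink k →L[ℝ] EndM n :=
  ∑ i, ∑ j, b i j • (θ j).smulRight (S i)

/-! ### The hyperplane `Hyp m` in `Hyp (m + 1)` -/

/-- The inclusion `x ↦ (x, 0)`. -/
def incl (m : ℕ) : Mink m →L[ℝ] Mink (m + 1) :=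
  ContinuousLinearMap.pi fun i =>
    Fin.lastCases (motive := fun _ => Mink m →L[ℝ] ℝ) 0 (fun j => ContinuousLinearMap.proj j) i

/-- The linear projection `(x, t) ↦ x`. -/
def trunc (m : ℕ) : Mink (m + 1) →L[ℝ] Mink m :=
  ContinuousLinearMap.pi fun i => ContinuousLinearMap.proj i.castSucc

/-- The unit normal vector `(0, 1)` of the hyperplane `Hyp m`. -/
def nrm (m : ℕ) : Mink (m + 1) := Pi.single (Fin.last _) 1

theorem incl_castSucc {m : ℕ} (x : Mink m) (i : Fin (m + 1)) : incl m x i.castSucc = x i := by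
  simp [incl]

theorem incl_last {m : ℕ} (x : Mink m) : incl m x (Fin.last _) = 0 := by
  simp [incl]

theorem trunc_apply {m : ℕ} (x : Mink (m + 1)) (i : Fin (m + 1)) : trunc m x i = x i.castSucc := rfl

theorem nrm_castSucc {m : ℕ} (i : Fin (m + 1)) : nrm m i.castSucc = 0 := by
  simp [nrm, (Fin.castSucc_lt_last i).ne]

theorem nrm_last {m : ℕ} : nrm m (Fin.last _) = 1 := by simp [nrm]

theorem lor_succ {m : ℕ} (x y : Mink (m + 1)) :
    lor (m + 1) x y = lor m (trunc m x) (trunc m y) + x (Fin.last _) * y (Fin.last _) := by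
  simp only [lor_apply, trunc_apply, Fin.sum_univ_castSucc (n := m), Fin.succ_castSucc,
    Fin.succ_last, Fin.castSucc_zero]
  ring

theorem trunc_mem_cone {m : ℕ} {z : Mink (m + 1)} (h : lor (m + 1) z z = -1 ∧ 0 < z 0) :
    trunc m z ∈ cone m := by
  refine ⟨?_, by simpa [trunc_apply] using h.2⟩
  have := h.1
  rw [lor_succ] at this
  nlinarith [mul_self_nonneg (z (Fin.last _))]

/-- A Lorentz transformation preserving the upper sheet preserves the future cone. -/
theorem isom_cone {m : ℕ} (g : Isom m) {x : Mink m} (h : x ∈ cone m) : g.1 x ∈ cone m := by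
  refine ⟨by rw [g.2.1]; exact h.1, ?_⟩
  have h1 := ((g.2.2 _).2 (normalize_mem h)).2
  have h2 : 0 < √(-lor m x x) := Real.sqrt_pos.2 (by have := h.1; linarith)
  rw [map_smul] at h1
  simp only [Pi.smul_apply, smul_eq_mul] at h1
  exact pos_of_mul_pos_right h1 (inv_pos.2 h2).le

/-- The linear map `g ⊕ 1`. -/
def extLin {m : ℕ} (g : EndM m) : EndM (m + 1) :=
  incl m ∘L g ∘L trunc m + (ContinuousLinearMap.proj (R := ℝ) (φ := fun _ => ℝ)
    (Fin.last (m + 1))).smulRight (nrm m)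

theorem trunc_extLin {m : ℕ} (g : EndM m) (x : Mink (m + 1)) :
    trunc m (extLin g x) = g (trunc m x) := by
  ext i
  simp [extLin, trunc_apply, incl_castSucc, nrm_castSucc]

theorem extLin_last {m : ℕ} (g : EndM m) (x : Mink (m + 1)) :
    extLin g x (Fin.last _) = x (Fin.last _) := by
  simp [extLin, incl_last, nrm_last]

theorem mink_ext {m : ℕ} {x y : Mink (m + 1)} (h : trunc m x = trunc m y)
    (h' : x (Fin.last _) = y (Fin.last _)) : x = y := by
  ext i
  refine Fin.lastCases h' (fun j => ?_) i
  exact congrFun h j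

/-- `g ⊕ 1` as a linear automorphism. -/
def extEquiv {m : ℕ} (g : Mink m ≃L[ℝ] Mink m) : Mink (m + 1) ≃L[ℝ] Mink (m + 1) :=
  ContinuousLinearEquiv.equivOfInverse (extLin g) (extLin g.symm)
    (fun x => mink_ext (by simp [trunc_extLin]) (by simp [extLin_last]))
    (fun x => mink_ext (by simp [trunc_extLin]) (by simp [extLin_last]))

theorem extEquiv_apply {m : ℕ} (g : Mink m ≃L[ℝ] Mink m) (x : Mink (m + 1)) :
    extEquiv g x = extLin g x := rfl

theorem extEquiv_lor {m : ℕ} (g : Isom m) (x y : Mink (m + 1)) :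
    lor (m + 1) (extEquiv g.1 x) (extEquiv g.1 y) = lor (m + 1) x y := by
  rw [lor_succ, lor_succ, extEquiv_apply, extEquiv_apply, trunc_extLin, trunc_extLin,
    extLin_last, extLin_last]
  exact congrArg (· + _) (g.2.1 _ _)

theorem extEquiv_pos {m : ℕ} (g : Isom m) {x : Mink (m + 1)}
    (h : lor (m + 1) x x = -1 ∧ 0 < x 0) : 0 < extEquiv g.1 x 0 := by
  have h1 := (isom_cone g (trunc_mem_cone h)).2
  have h2 := congrFun (trunc_extLin (g.1 : EndM m) x) 0
  rw [extEquiv_apply]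
  simpa [trunc_apply] using h2.trans_gt h1

/-- The inclusion `g ↦ g ⊕ 1` of `Isom m` in `Isom (m + 1)`. -/
def extIsom (m : ℕ) : Isom m →* Isom (m + 1) where
  toFun g := ⟨extEquiv g.1, extEquiv_lor g, fun x => by
    refine ⟨fun h => ⟨by rw [← extEquiv_lor g]; exact h.1, ?_⟩,
      fun h => ⟨by rw [extEquiv_lor g]; exact h.1, extEquiv_pos g h⟩⟩
    have h3 := extEquiv_pos g⁻¹ h
    have h4 : extEquiv (g⁻¹).1 (extEquiv g.1 x) = x := (extEquiv g.1).symm_apply_apply x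
    rwa [h4] at h3⟩
  map_one' := by
    apply Subtype.ext
    refine ContinuousLinearEquiv.ext (funext fun x => ?_)
    exact mink_ext (trunc_extLin _ _) (extLin_last _ _)
  map_mul' g h := by
    apply Subtype.ext
    refine ContinuousLinearEquiv.ext (funext fun x => ?_)
    refine mink_ext ((trunc_extLin _ _).trans ?_) ((extLin_last _ _).trans ?_)
    · exact ((trunc_extLin _ _).trans (congrArg g.1 (trunc_extLin _ _))).symm
    · exact ((extLin_last _ _).trans (extLin_last _ _)).symm

theorem fermi_mem {m : ℕ} (x : Hyp m) (r : ℝ) :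
    lor (m + 1) (Real.cosh r • incl m x.1 + Real.sinh r • nrm m)
      (Real.cosh r • incl m x.1 + Real.sinh r • nrm m) = -1 ∧
    0 < (Real.cosh r • incl m x.1 + Real.sinh r • nrm m) 0 := by
  have h0 : trunc m (Real.cosh r • incl m x.1 + Real.sinh r • nrm m) = Real.cosh r • x.1 := by
    ext i
    simp [trunc_apply, incl_castSucc, nrm_castSucc]
  constructor
  · rw [lor_succ, h0]
    simp only [map_smul, LinearMap.smul_apply, smul_eq_mul, x.2.1, Pi.add_apply, Pi.smul_apply,
      incl_last, nrm_last]
    nlinarith [Real.cosh_sq r]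
  · have h1 := congrFun h0 0
    rw [trunc_apply, Fin.castSucc_zero] at h1
    rw [h1]
    exact mul_pos (Real.cosh_pos r) x.2.2

/-- The identification of `Hyp m × ℝ` with `Hyp (m + 1)`: the point at signed distance `r` from `x`
on the unit speed geodesic through `x` normal to the hyperplane `Hyp m`. -/
def fermi {m : ℕ} (x : Hyp m) (r : ℝ) : Hyp (m + 1) :=
  ⟨Real.cosh r • incl m x.1 + Real.sinh r • nrm m, fermi_mem x r⟩

/-- The unit normal `n` of the slices `Hyp m × {r}`: the derivative of `fermi x r` in `r`. -/
def nrmAt {m : ℕ} (x : Hyp m) (r : ℝ) : Mink (m + 1) :=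
  Real.sinh r • incl m x.1 + Real.cosh r • nrm m

/-- The extension of a tangent vector `v` of `Hyp m` at `x` to the point `(x, r)`: `sech r` times the
vector that the product structure determines, i.e. times the derivative of `fermi · r` along `v`. -/
def extVec {m : ℕ} (x : Hyp m) (r : ℝ) (v : Mink m) : Mink (m + 1) :=
  (Real.cosh r)⁻¹ • dHyp (fun y : Hyp m => (fermi y r).1) x v

/-- The orthogonal projection of `Hyp (m + 1)` onto the hyperplane `Hyp m`. -/
def orthProj {m : ℕ} (p : Hyp (m + 1)) : Hyp m := retr (trunc m p.1)

theorem orthProj_fermi {m : ℕ} (x : Hyp m) (r : ℝ) : orthProj (fermi x r) = x := by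
  have hc := trunc_mem_cone (fermi x r).2
  have h0 : trunc m (fermi x r).1 = Real.cosh r • x.1 := by
    ext i
    simp [fermi, trunc_apply, incl_castSucc, nrm_castSucc]
  apply Subtype.ext
  rw [orthProj, retr, dif_pos hc]
  simp only [h0, map_smul, LinearMap.smul_apply, smul_eq_mul, x.2.1]
  rw [show -(Real.cosh r * (Real.cosh r * -1)) = Real.cosh r ^ 2 by ring,
    Real.sqrt_sq (Real.cosh_pos r).le, smul_smul, inv_mul_cancel₀ (Real.cosh_pos r).ne', one_smul]

/-- The coordinates `(x, r)` cover `Hyp (m + 1)`. -/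
theorem fermi_orthProj {m : ℕ} (p : Hyp (m + 1)) :
    fermi (orthProj p) (Real.arsinh (p.1 (Fin.last _))) = p := by
  have hc := trunc_mem_cone p.2
  have h1 : -lor m (trunc m p.1) (trunc m p.1) = 1 + p.1 (Fin.last _) ^ 2 := by
    have := p.2.1
    rw [lor_succ] at this
    linarith
  have h2 : 0 < √(1 + p.1 (Fin.last _) ^ 2) := by positivity
  apply Subtype.ext
  refine mink_ext ?_ ?_
  · ext i
    simp only [fermi, orthProj, retr, dif_pos hc, h1, Real.cosh_arsinh, trunc_apply, Pi.add_apply,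
      Pi.smul_apply, incl_castSucc, nrm_castSucc, smul_eq_mul]
    field_simp
    ring
  · simp [fermi, incl_last, nrm_last, Real.sinh_arsinh]

/-- The pullback `π* α` under the orthogonal projection `π`, for forms with flat coefficients:
`(π* α)(v) = α(dπ v)`. -/
def pullProj {m : ℕ} (α : Hyp m → Mink m →L[ℝ] F) (p : Hyp (m + 1)) : Mink (m + 1) →L[ℝ] F :=
  α (orthProj p) ∘L dHyp (fun q : Hyp (m + 1) => (orthProj q).1) p

end Fuchsian

end

noncomputable section

namespace Fuchsian

variable {F : Type*} [NormedAddCommGroup F] [NormedSpace ℝ F]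

/-! ### The Lorentz form -/

/-! The form is `π*B`, with coefficients taken in the fixed Lie algebra.

Frame formula: `R_{ni}` is the skew endomorphism `transl n e_i`, with no reference to the base point
(`rot_eq_transl`). At the point `p` over `x` at height `r`, `n - tanh r • p = sech r • nrm m`, so
`R_{ni} - tanh r E_i` is `sech r` times the value of `R_{ni}` on the hyperplane. The same factor
relates `π*ω_j` to the extended `ω_j`.

Closedness survives pullback. For the codifferential, the geometric connection is `∇_v = D_v - ad
E_v`, with `D` the flat derivative (`nablaE_eq`). Hence `D* = T* - div` and `δ = 2T* - div`, where
`div α = ∑ (D_{e_j} α)(e_j)` (`Dstar_eq`). Symmetry and tracelessness of `b` make `T*` vanish on `B`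
and on `π*B` alike (`sum_bracket_eq_zero`), so co-closedness of `B` says `div B = 0`. Since `div
π*B` is `sech² r` times `div B` (`sum_dHyp_pullProj`), both `D*` and `δ` vanish on `π*B`.

The calculus uses extensions to the cone that are constant along rays. There `π*B` is `B ∘ trunc`
divided by the Lorentz length of `trunc p`, which is `cosh r` (`pullProj_eq`). Sums over frames are
Lorentz traces, up to the contribution of the base point. -/

theorem lor_comm {n : ℕ} (x y : Mink n) : lor n x y = lor n y x := by
  simp only [lor_apply, mul_comm]

theorem flat_apply {n : ℕ} (v w : Mink n) : flat v w = lor n v w := rfl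

theorem trunc_incl {m : ℕ} (x : Mink m) : trunc m (incl m x) = x := by
  ext i
  simp [trunc_apply, incl_castSucc]

theorem trunc_nrm (m : ℕ) : trunc m (nrm m) = 0 := by
  ext i
  simp [trunc_apply, nrm_castSucc]

theorem lor_incl {m : ℕ} (x : Mink m) (z : Mink (m + 1)) :
    lor (m + 1) (incl m x) z = lor m x (trunc m z) := by
  rw [lor_succ, trunc_incl, incl_last, zero_mul, add_zero]

theorem lor_incl_incl {m : ℕ} (x y : Mink m) :
    lor (m + 1) (incl m x) (incl m y) = lor m x y := by
  rw [lor_incl, trunc_incl]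

theorem lor_nrm {m : ℕ} (z : Mink (m + 1)) : lor (m + 1) (nrm m) z = z (Fin.last _) := by
  rw [lor_succ, trunc_nrm, nrm_last]
  simp

/-! ### Infinitesimal isometries -/

theorem transl_apply {n : ℕ} (u v z : Mink n) :
    transl u v z = lor n v z • u - lor n u z • v := rfl

theorem transl_self {n : ℕ} (u : Mink n) : transl u u = 0 := sub_self _

theorem transl_swap {n : ℕ} (u v : Mink n) : transl u v = -transl v u := (neg_sub _ _).symm

theorem transl_add_left {n : ℕ} (u u' v : Mink n) :
    transl (u + u') v = transl u v + transl u' v := by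
  ext z : 1
  simp only [transl_apply, add_apply, map_add, LinearMap.add_apply]
  module

theorem transl_smul_left {n : ℕ} (c : ℝ) (u v : Mink n) : transl (c • u) v = c • transl u v := by
  ext z : 1
  simp only [transl_apply, smul_apply, map_smul, LinearMap.smul_apply,
    smul_eq_mul]
  module

theorem transl_add_right {n : ℕ} (u v v' : Mink n) :
    transl u (v + v') = transl u v + transl u v' := by
  rw [transl_swap, transl_add_left, transl_swap v, transl_swap v']
  abel

theorem transl_smul_right {n : ℕ} (c : ℝ) (u v : Mink n) : transl u (c • v) = c • transl u v := by
  rw [transl_swap, transl_smul_left, transl_swap v, smul_neg, neg_neg]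

theorem bracket_apply {n : ℕ} (X Y : EndM n) (z : Mink n) : ⁅X, Y⁆ z = X (Y z) - Y (X z) := rfl

/-- `X` is skew for the Lorentz form. -/
def IsSkew {n : ℕ} (X : EndM n) : Prop := ∀ a b, lor n (X a) b = -lor n a (X b)

theorem isSkew_iff {n : ℕ} {X : EndM n} :
    IsSkew X ↔ (X : Mink n →ₗ[ℝ] Mink n) ∈ skewAdjointLieSubalgebra (lor n) := by
  refine Iff.trans ?_ (LinearMap.mem_skewAdjointSubmodule (X : Mink n →ₗ[ℝ] Mink n)).symm
  refine forall₂_congr fun a b => ?_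
  simp

theorem isSkew_transl {n : ℕ} (u v : Mink n) : IsSkew (transl u v) := fun a b => by
  simp only [transl_apply, map_sub, map_smul, LinearMap.sub_apply, LinearMap.smul_apply,
    smul_eq_mul, lor_comm a]
  ring

theorem IsSkew.smul {n : ℕ} {X : EndM n} (hX : IsSkew X) (c : ℝ) : IsSkew (c • X) := fun a b => by
  simp [hX a b]

theorem IsSkew.bracket_transl {n : ℕ} {X : EndM n} (hX : IsSkew X) (u v : Mink n) :
    ⁅X, transl u v⁆ = transl (X u) v + transl u (X v) := by
  ext z : 1
  simp only [bracket_apply, transl_apply, add_apply, map_sub, map_smul, hX u z,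
    hX v z]
  module

/-- The bracket moves only the factor `p` of `transl p v`, sending it to `u`. The base point
therefore drops out, which makes rotations at different heights comparable. -/
theorem rot_eq_transl {n : ℕ} {p u v : Mink n} (hp : lor n p p = -1) (hu : lor n p u = 0)
    (hv : lor n p v = 0) : rot p u v = transl u v := by
  rw [rot, (isSkew_transl p u).bracket_transl]
  simp only [transl_apply, lor_comm u p, hp, hu, hv]
  rw [zero_smul, zero_smul, zero_sub, neg_smul, one_smul, neg_neg, sub_zero, transl_smul_right,
    transl_self, smul_zero, add_zero]

theorem tproj_apply {n : ℕ} (p z : Mink n) : tproj p z = z + lor n p z • p := rfl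

theorem tproj_tangent {n : ℕ} {p v : Mink n} (hv : lor n p v = 0) : tproj p v = v := by
  rw [tproj_apply, hv]
  module

theorem lor_tproj {n : ℕ} {p : Mink n} (hp : lor n p p = -1) (z : Mink n) :
    lor n p (tproj p z) = 0 := by
  simp [tproj_apply, hp]

/-! ### Traces over orthonormal frames -/

/-- The trace with respect to the Lorentz form. -/
def lorTrace {n : ℕ} (Φ : Mink n →ₗ[ℝ] Mink n →ₗ[ℝ] F) : F :=
  ∑ a, (if a = 0 then -1 else 1 : ℝ) • Φ (Pi.single a 1) (Pi.single a 1)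

theorem bilin_expand {n : ℕ} (Φ : Mink n →ₗ[ℝ] Mink n →ₗ[ℝ] F) (x y : Mink n) :
    Φ x y = ∑ a, ∑ b, (x a * y b) • Φ (Pi.single a 1) (Pi.single b 1) := by
  conv_lhs => rw [pi_eq_sum_univ' x, pi_eq_sum_univ' y]
  simp only [map_sum, map_smul, LinearMap.sum_apply, LinearMap.smul_apply, Finset.smul_sum,
    smul_smul]
  rw [Finset.sum_comm]
  simp only [mul_comm]

theorem lor_eq_sum {n : ℕ} (x y : Mink n) :
    lor n x y = ∑ a, (if a = 0 then -1 else 1) * (x a * y a) := by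
  rw [Fin.sum_univ_succ]
  simp [lor_apply, Fin.succ_ne_zero]

/-- The matrix with rows `p, e` is Lorentz orthogonal, hence so is its transpose; this is the
orthonormality of its columns. -/
theorem IsFrameAt.sum_mul {n : ℕ} {p : Hyp n} {e : Fin n → Mink n} (he : IsFrameAt p e)
    (a b : Fin (n + 1)) :
    ∑ k, e k a * e k b = p.1 a * p.1 b + if a = b then (if a = 0 then -1 else 1) else 0 := by
  let P : Matrix (Fin (n + 1)) (Fin (n + 1)) ℝ := Matrix.of (Fin.cons p.1 e)
  let η : Matrix (Fin (n + 1)) (Fin (n + 1)) ℝ := Matrix.diagonal fun a => if a = 0 then -1 else 1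
  have hη : η * η = 1 := by
    rw [Matrix.diagonal_mul_diagonal, ← Matrix.diagonal_one]
    congr 1
    ext i
    split_ifs <;> norm_num
  have h1 : P * η * P.transpose = η := by
    ext i j
    have h : (P * η * P.transpose) i j = lor n (P i) (P j) := by
      rw [lor_eq_sum, Matrix.mul_apply]
      refine Finset.sum_congr rfl fun k _ => ?_
      rw [Matrix.mul_diagonal, Matrix.transpose_apply]
      ring
    rw [h]
    have hP0 : P 0 = p.1 := rfl
    have hPs : ∀ k : Fin n, P k.succ = e k := fun k => rfl
    refine Fin.cases ?_ (fun i => ?_) i <;> refine Fin.cases ?_ (fun j => ?_) j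
    · simpa [hP0, η] using p.2.1
    · simpa [hP0, hPs, η, Matrix.diagonal_apply, (Fin.succ_ne_zero _).symm] using he.1 j
    · simpa [hP0, hPs, η, Matrix.diagonal_apply, Fin.succ_ne_zero, lor_comm] using he.1 i
    · simpa [hPs, η, Matrix.diagonal_apply, Fin.succ_ne_zero] using he.2 i j
  -- A right inverse of a square matrix is a left inverse, which passes from rows to columns.
  have h2 : P * (η * P.transpose * η) = 1 := by
    rw [← hη]
    nth_rewrite 3 [← h1]
    simp only [Matrix.mul_assoc]
  have h3 : P.transpose * η * P = η := by
    have := congrArg (η * ·) (mul_eq_one_comm.1 h2)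
    simp only [← Matrix.mul_assoc, hη, Matrix.one_mul, Matrix.mul_one] at this
    exact this
  have h4 := congrFun₂ h3 a b
  rw [Matrix.mul_apply, Fin.sum_univ_succ] at h4
  simp only [η, P, Matrix.mul_diagonal, Matrix.transpose_apply, Matrix.of_apply, Fin.cons_zero,
    Fin.cons_succ, Fin.succ_ne_zero, if_true, if_false, Matrix.diagonal_apply, mul_one] at h4
  linarith

/-- The right-hand side does not involve `e`, so such sums may be computed in any frame at `p`. The
timelike `p` enters the full trace with sign `-1`, hence the term `Φ p p`. -/
theorem IsFrameAt.sum_eq {n : ℕ} {p : Hyp n} {e : Fin n → Mink n} (he : IsFrameAt p e)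
    (Φ : Mink n →ₗ[ℝ] Mink n →ₗ[ℝ] F) :
    ∑ k, Φ (e k) (e k) = Φ p.1 p.1 + lorTrace Φ := by
  simp only [bilin_expand Φ (e _), bilin_expand Φ p.1]
  rw [Finset.sum_comm]
  simp only [Finset.sum_comm (s := Finset.univ (α := Fin n)), ← Finset.sum_smul, he.sum_mul,
    add_smul, Finset.sum_add_distrib, lorTrace]
  congr 1
  refine Finset.sum_congr rfl fun a _ => ?_
  simp [ite_smul]

theorem lorTrace_succ {m : ℕ} (Φ : Mink (m + 1) →ₗ[ℝ] Mink (m + 1) →ₗ[ℝ] F) :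
    lorTrace Φ = lorTrace (Φ.compl₁₂ (incl m : Mink m →ₗ[ℝ] _) (incl m : Mink m →ₗ[ℝ] _)) +
      Φ (nrm m) (nrm m) := by
  have h : ∀ a : Fin (m + 1), incl m (Pi.single a 1) = Pi.single a.castSucc 1 := fun a => by
    refine mink_ext ?_ ?_
    · rw [trunc_incl]
      ext i
      simp [trunc_apply, Pi.single_apply]
    · simp [incl_last, (Fin.castSucc_lt_last a).ne]
  rw [lorTrace, Fin.sum_univ_castSucc]
  simp only [lorTrace, LinearMap.compl₁₂_apply, ContinuousLinearMap.coe_coe, h, nrm,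
    Fin.castSucc_eq_zero_iff, Fin.last_eq_zero_iff, Nat.succ_ne_zero, if_false, one_smul]

/-! ### The radial retraction -/

/-- The Lorentz length of a timelike vector. -/
def mlen {n : ℕ} (z : Mink n) : ℝ := √(-lor n z z)

theorem mlen_pos {n : ℕ} {z : Mink n} (hz : z ∈ cone n) : 0 < mlen z :=
  Real.sqrt_pos.2 (neg_pos.2 hz.1)

theorem mlen_smul {n : ℕ} {c : ℝ} (hc : 0 < c) (z : Mink n) : mlen (c • z) = c * mlen z := by
  rw [mlen, mlen, map_smul, map_smul, LinearMap.smul_apply, smul_eq_mul, smul_eq_mul,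
    show -(c * (c * lor n z z)) = c ^ 2 * -lor n z z by ring, Real.sqrt_mul (sq_nonneg c),
    Real.sqrt_sq hc.le]

theorem mlen_coe {n : ℕ} (p : Hyp n) : mlen p.1 = 1 := by
  rw [mlen, p.2.1, neg_neg, Real.sqrt_one]

theorem coe_mem_cone {n : ℕ} (p : Hyp n) : p.1 ∈ cone n :=
  ⟨by rw [p.2.1]; norm_num, p.2.2⟩

theorem smul_mem_cone {n : ℕ} {c : ℝ} (hc : 0 < c) {z : Mink n} (hz : z ∈ cone n) :
    c • z ∈ cone n := by
  refine ⟨?_, mul_pos hc hz.2⟩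
  rw [map_smul, map_smul, LinearMap.smul_apply, smul_eq_mul, smul_eq_mul]
  exact mul_neg_of_pos_of_neg hc (mul_neg_of_pos_of_neg hc hz.1)

theorem trunc_mem_cone_of_mem {m : ℕ} {z : Mink (m + 1)} (hz : z ∈ cone (m + 1)) :
    trunc m z ∈ cone m := by
  refine ⟨?_, by simpa [trunc_apply] using hz.2⟩
  have := hz.1
  rw [lor_succ] at this
  nlinarith [mul_self_nonneg (z (Fin.last _))]

theorem retr_coe {n : ℕ} {z : Mink n} (hz : z ∈ cone n) : (retr z).1 = (mlen z)⁻¹ • z := by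
  rw [retr, dif_pos hz, mlen]

theorem retr_smul {n : ℕ} {c : ℝ} (hc : 0 < c) {z : Mink n} (hz : z ∈ cone n) :
    retr (c • z) = retr z := by
  apply Subtype.ext
  rw [retr_coe hz, retr_coe (smul_mem_cone hc hz), mlen_smul hc, smul_smul]
  congr 1
  field_simp

theorem retr_self {n : ℕ} (p : Hyp n) : retr p.1 = p := by
  apply Subtype.ext
  rw [retr_coe (coe_mem_cone p), mlen_coe, inv_one, one_smul]

/-- The Lorentz form as a continuous linear map to the dual space. -/
def flatL (n : ℕ) : Mink n →L[ℝ] Mink n →L[ℝ] ℝ :=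
  LinearMap.toContinuousLinearMap
    ((LinearMap.toContinuousLinearMap : (Mink n →ₗ[ℝ] ℝ) ≃ₗ[ℝ] _).toLinearMap ∘ₗ lor n)

theorem flatL_apply {n : ℕ} (v w : Mink n) : flatL n v w = lor n v w := rfl

theorem contDiff_lor_self (n : ℕ) : ContDiff ℝ ∞ fun z : Mink n => lor n z z :=
  (flatL n).contDiff.clm_apply contDiff_id

theorem isOpen_cone (n : ℕ) : IsOpen (cone n) :=
  (isOpen_lt (contDiff_lor_self n).continuous continuous_const).inter
    (isOpen_lt continuous_const (continuous_apply 0))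

theorem cone_mem_nhds {n : ℕ} (p : Hyp n) : cone n ∈ nhds p.1 :=
  (isOpen_cone n).mem_nhds (coe_mem_cone p)

theorem contDiffOn_mlen (n : ℕ) : ContDiffOn ℝ ∞ (mlen (n := n)) (cone n) :=
  (contDiff_lor_self n).neg.contDiffOn.sqrt fun _ hz => (neg_pos.2 hz.1).ne'

theorem hasFDerivAt_mlen {n : ℕ} {z : Mink n} (hz : z ∈ cone n) :
    HasFDerivAt (mlen (n := n)) (-(mlen z)⁻¹ • flatL n z) z := by
  have h1 : HasFDerivAt (fun z : Mink n => -lor n z z) _ z :=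
    ((flatL n).hasFDerivAt.clm_apply (hasFDerivAt_id z)).neg
  refine (h1.sqrt (neg_pos.2 hz.1).ne').congr_fderiv ?_
  ext v : 1
  have := (mlen_pos hz).ne'
  simp only [smul_apply, neg_apply, add_apply, ContinuousLinearMap.comp_apply,
    ContinuousLinearMap.flip_apply, flatL_apply, smul_eq_mul, ContinuousLinearMap.id_apply, id,
    lor_comm v z]
  change 1 / (2 * mlen z) * _ = _
  field_simp
  ring

theorem hasFDerivAt_inv_mlen {n : ℕ} {z : Mink n} (hz : z ∈ cone n) :
    HasFDerivAt (fun z : Mink n => (mlen z)⁻¹) ((mlen z)⁻¹ ^ 3 • flatL n z) z := by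
  refine ((hasDerivAt_inv (mlen_pos hz).ne').comp_hasFDerivAt z (hasFDerivAt_mlen hz)).congr_fderiv
    ?_
  have := (mlen_pos hz).ne'
  rw [smul_smul]
  congr 1
  field_simp

theorem smoothOnHyp_coe (n : ℕ) : SmoothOnHyp fun p : Hyp n => p.1 :=
  (((contDiffOn_mlen n).inv fun _ hz => (mlen_pos hz).ne').smul contDiffOn_id).congr
    fun _ hz => retr_coe hz

/-! ### Derivatives on hyperbolic space -/

theorem SmoothOnHyp.differentiableAt {n : ℕ} {f : Hyp n → F} (hf : SmoothOnHyp f) {z : Mink n}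
    (hz : z ∈ cone n) : DifferentiableAt ℝ (fun z => f (retr z)) z :=
  (hf.contDiffAt ((isOpen_cone n).mem_nhds hz)).differentiableAt (by simp)

/-- `f` is differentiable at `p`. -/
def DiffAtHyp {n : ℕ} (f : Hyp n → F) (p : Hyp n) : Prop :=
  DifferentiableAt ℝ (fun z => f (retr z)) p.1

theorem SmoothOnHyp.diffAtHyp {n : ℕ} {f : Hyp n → F} (hf : SmoothOnHyp f) (p : Hyp n) :
    DiffAtHyp f p := hf.differentiableAt (coe_mem_cone p)

theorem diffAtHyp_coe {n : ℕ} (p : Hyp n) : DiffAtHyp (fun p : Hyp n => p.1) p :=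
  (smoothOnHyp_coe n).diffAtHyp p

section

variable {G H : Type*} [NormedAddCommGroup G] [NormedSpace ℝ G] [NormedAddCommGroup H]
  [NormedSpace ℝ H] {n : ℕ} {p : Hyp n}

theorem DiffAtHyp.clm_apply {f : Hyp n → F →L[ℝ] G} {g : Hyp n → F} (hf : DiffAtHyp f p)
    (hg : DiffAtHyp g p) : DiffAtHyp (fun y => f y (g y)) p :=
  DifferentiableAt.clm_apply hf hg

theorem DiffAtHyp.clm_comp {f : Hyp n → G →L[ℝ] H} {g : Hyp n → F →L[ℝ] G} (hf : DiffAtHyp f p)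
    (hg : DiffAtHyp g p) : DiffAtHyp (fun y => f y ∘L g y) p :=
  DifferentiableAt.clm_comp hf hg

theorem DiffAtHyp.clm (L : F →L[ℝ] G) {f : Hyp n → F} (hf : DiffAtHyp f p) :
    DiffAtHyp (fun y => L (f y)) p :=
  L.differentiableAt.comp p.1 hf

theorem DiffAtHyp.smul {f : Hyp n → ℝ} {g : Hyp n → F} (hf : DiffAtHyp f p)
    (hg : DiffAtHyp g p) : DiffAtHyp (fun y => f y • g y) p :=
  DifferentiableAt.smul hf hg

theorem DiffAtHyp.add {f g : Hyp n → F} (hf : DiffAtHyp f p)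
    (hg : DiffAtHyp g p) : DiffAtHyp (fun y => f y + g y) p :=
  DifferentiableAt.add hf hg

theorem diffAtHyp_const (c : F) : DiffAtHyp (fun _ : Hyp n => c) p :=
  differentiableAt_const c

theorem dHyp_clm_apply {f : Hyp n → F →L[ℝ] G} {g : Hyp n → F} (hf : DiffAtHyp f p)
    (hg : DiffAtHyp g p) (v : Mink n) :
    dHyp (fun y => f y (g y)) p v = dHyp f p v (g p) + f p (dHyp g p v) := by
  rw [dHyp, fderiv_clm_apply hf hg]
  simp only [add_apply, ContinuousLinearMap.comp_apply,
    ContinuousLinearMap.flip_apply, retr_self]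
  exact add_comm _ _

theorem dHyp_clm (L : F →L[ℝ] G) {f : Hyp n → F} (hf : DiffAtHyp f p) (v : Mink n) :
    dHyp (fun y => L (f y)) p v = L (dHyp f p v) := by
  have : HasFDerivAt (fun z => L (f (retr z))) (L ∘L dHyp f p) p.1 :=
    L.hasFDerivAt.comp p.1 hf.hasFDerivAt
  rw [dHyp, this.fderiv]
  rfl

theorem dHyp_apply_const {f : Hyp n → F →L[ℝ] G} (hf : DiffAtHyp f p) (v : Mink n) (w : F) :
    dHyp (fun y => f y w) p v = dHyp f p v w :=
  dHyp_clm (ContinuousLinearMap.apply ℝ G w) hf v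

theorem dHyp_smul {f : Hyp n → ℝ} {g : Hyp n → F} (hf : DiffAtHyp f p)
    (hg : DiffAtHyp g p) (v : Mink n) :
    dHyp (fun y => f y • g y) p v = dHyp f p v • g p + f p • dHyp g p v := by
  rw [dHyp, fderiv_fun_smul hf hg]
  simp only [add_apply, smul_apply, ContinuousLinearMap.smulRight_apply, retr_self]
  exact add_comm _ _

theorem dHyp_add {f g : Hyp n → F} (hf : DiffAtHyp f p)
    (hg : DiffAtHyp g p) (v : Mink n) :
    dHyp (fun y => f y + g y) p v = dHyp f p v + dHyp g p v := by
  rw [dHyp, fderiv_fun_add hf hg]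
  rfl

theorem dHyp_const (c : F) (v : Mink n) : dHyp (fun _ : Hyp n => c) p v = 0 := by
  simp [dHyp]

/-- The extension `f ∘ retr` is constant along the ray through `p`. -/
theorem dHyp_self {f : Hyp n → F} (hf : DiffAtHyp f p) : dHyp f p p.1 = 0 := by
  have h1 : HasDerivAt (fun t : ℝ => t • p.1) p.1 1 := by
    simpa using (hasDerivAt_id (1 : ℝ)).smul_const p.1
  have h2 : HasFDerivAt (fun z => f (retr z)) (dHyp f p) ((1 : ℝ) • p.1) := by
    rw [one_smul]
    exact hf.hasFDerivAt
  have h3 := h2.comp_hasDerivAt (1 : ℝ) h1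
  have h4 : (fun _ : ℝ => f p) =ᶠ[nhds 1] (fun z => f (retr z)) ∘ fun t : ℝ => t • p.1 := by
    filter_upwards [lt_mem_nhds (zero_lt_one (α := ℝ))] with t ht
    rw [Function.comp_apply, retr_smul ht (coe_mem_cone p), retr_self]
  exact (h3.congr_of_eventuallyEq h4).unique (hasDerivAt_const _ _)

/-- The derivative at a multiple of `p` of the radial extension of `f`. -/
theorem hasFDerivAt_retr_smul {f : Hyp n → F} (hf : SmoothOnHyp f) (p : Hyp n) {c : ℝ}
    (hc : 0 < c) : HasFDerivAt (fun z => f (retr z)) (c⁻¹ • dHyp f p) (c • p.1) := by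
  have h1 := (hf.differentiableAt (smul_mem_cone hc (coe_mem_cone p))).hasFDerivAt
  have h2 : HasFDerivAt (fun z : Mink n => c • z) (c • ContinuousLinearMap.id ℝ (Mink n)) p.1 :=
    (hasFDerivAt_id p.1).const_smul c
  have h3 := (h1.comp p.1 h2).congr_of_eventuallyEq (f₁ := fun z => f (retr z)) (by
    filter_upwards [cone_mem_nhds p] with z hz
    rw [Function.comp_apply, retr_smul hc hz])
  refine h1.congr_fderiv ?_
  rw [dHyp, h3.fderiv]
  ext v
  simp [smul_smul, hc.ne']

theorem dHyp_coe (p : Hyp n) (v : Mink n) : dHyp (fun y : Hyp n => y.1) p v = tproj p.1 v := by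
  have h1 := (hasFDerivAt_inv_mlen (coe_mem_cone p)).fun_smul (hasFDerivAt_id p.1)
  have h2 := h1.congr_of_eventuallyEq (f₁ := fun z => (retr z).1) (by
    filter_upwards [cone_mem_nhds p] with z hz
    exact retr_coe hz)
  rw [dHyp, h2.fderiv, tproj_apply, mlen_coe]
  simp [flatL_apply]

end

/-! ### The geometric connection in terms of the flat one -/

section

variable {k n : ℕ} {ι : Mink k →L[ℝ] Mink n} {p : Hyp k}

theorem bracket_swap {n : ℕ} (X Y : EndM n) : ⁅X, Y⁆ = -⁅Y, X⁆ := (neg_sub _ _).symm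

theorem tproj_eq_flatL (q a : Mink n) : tproj q a = a + flatL n q a • q := rfl

theorem DiffAtHyp.tproj {h : Hyp k → Mink n} (hh : DiffAtHyp h p) (ι : Mink k →L[ℝ] Mink n) :
    DiffAtHyp (fun y => tproj (ι y.1) (h y)) p := by
  simp only [tproj_eq_flatL]
  have hι := (diffAtHyp_coe p).clm ι
  exact hh.add (((hι.clm (flatL n)).clm_apply hh).smul hι)

/-- The last two terms come from the motion of the tangent space, as in the Gauss formula. -/
theorem dHyp_tproj {h : Hyp k → Mink n} (hh : DiffAtHyp h p) (ι : Mink k →L[ℝ] Mink n)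
    {v : Mink k} (hv : lor k p.1 v = 0) :
    dHyp (fun y => tproj (ι y.1) (h y)) p v =
      tproj (ι p.1) (dHyp h p v) + lor n (ι v) (h p) • ι p.1 + lor n (ι p.1) (h p) • ι v := by
  have hι := (diffAtHyp_coe p).clm ι
  have hd : dHyp (fun y : Hyp k => ι y.1) p v = ι v := by
    rw [dHyp_clm ι (diffAtHyp_coe p), dHyp_coe, tproj_tangent hv]
  simp only [tproj_eq_flatL]
  rw [dHyp_add hh (((hι.clm (flatL n)).clm_apply hh).smul hι),
    dHyp_smul ((hι.clm (flatL n)).clm_apply hh) hι, dHyp_clm_apply (hι.clm (flatL n)) hh,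
    dHyp_clm (flatL n) hι, hd]
  simp only [flatL_apply]
  module

/-- Skewness is the vanishing of the linear functionals `V ↦ ⟨b, V a⟩ + ⟨a, V b⟩`, which commute
with differentiation. -/
theorem isSkew_dHyp {V : Hyp k → EndM n} (hV : DiffAtHyp V p) (hs : ∀ y, IsSkew (V y))
    (v : Mink k) : IsSkew (dHyp V p v) := by
  intro a b
  have h1 := dHyp_clm (flatL n b ∘L ContinuousLinearMap.apply ℝ (Mink n) a +
    flatL n a ∘L ContinuousLinearMap.apply ℝ (Mink n) b) hV v
  have h2 : (fun y => (flatL n b ∘L ContinuousLinearMap.apply ℝ (Mink n) a +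
    flatL n a ∘L ContinuousLinearMap.apply ℝ (Mink n) b) (V y)) = fun _ => 0 := by
    ext y
    change lor n b (V y a) + lor n a (V y b) = 0
    rw [lor_comm b, hs y a b]
    ring
  rw [h2, dHyp_const] at h1
  change 0 = lor n b (dHyp V p v a) + lor n a (dHyp V p v b) at h1
  rw [lor_comm b] at h1
  linarith

/-- Conceptually, the flow of `E_v` carries the splitting into translations and rotations along the
geodesic, and parallel transport is `Ad (exp (t E_v))`; differentiating gives the term `-ad E_v`.
The proof is a direct evaluation on vectors. -/
theorem nablaE_eq (hι : ∀ x y, lor n (ι x) (ι y) = lor k x y) {V : Hyp k → EndM n}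
    (hV : DiffAtHyp V p) (hs : ∀ y, IsSkew (V y)) {v : Mink k} (hv : lor k p.1 v = 0) :
    nablaE ι V p v = dHyp V p v - ⁅transl (ι p.1) (ι v), V p⁆ := by
  have hco := (diffAtHyp_coe p).clm ι
  have hd : dHyp (fun y : Hyp k => ι y.1) p v = ι v := by
    rw [dHyp_clm ι (diffAtHyp_coe p), dHyp_coe, tproj_tangent hv]
  have hY := isSkew_dHyp hV hs v
  have hX := hs p
  have hPP : lor n (ι p.1) (ι p.1) = -1 := by rw [hι, p.2.1]
  have hPv : lor n (ι p.1) (ι v) = 0 := by rw [hι, hv]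
  have hvP : lor n (ι v) (ι p.1) = 0 := by rw [lor_comm, hPv]
  -- Evaluated at a fixed `z`, the conjugated operator is two nested projections of vectors, so
  -- `dHyp_tproj` applies twice.
  have hW : ∀ z, dHyp (fun y => tproj (ι y.1) ∘L V y ∘L tproj (ι y.1)) p v z =
      tproj (ι p.1) (dHyp V p v (tproj (ι p.1) z) +
        V p (lor n (ι v) z • ι p.1 + lor n (ι p.1) z • ι v)) +
      lor n (ι v) (V p (tproj (ι p.1) z)) • ι p.1 +
      lor n (ι p.1) (V p (tproj (ι p.1) z)) • ι v := by
    intro z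
    have ht : DiffAtHyp (fun y : Hyp k => tproj (ι y.1)) p := by
      have h1 : DiffAtHyp (fun y : Hyp k => ContinuousLinearMap.smulRightL ℝ (Mink n) (Mink n)
        (flatL n (ι y.1)) (ι y.1)) p :=
        ((hco.clm (flatL n)).clm (ContinuousLinearMap.smulRightL ℝ (Mink n) (Mink n))).clm_apply hco
      exact (diffAtHyp_const (ContinuousLinearMap.id ℝ (Mink n))).add h1
    have htz := (diffAtHyp_const (p := p) z).tproj ι
    rw [← dHyp_apply_const (ht.clm_comp (hV.clm_comp ht)) v z]
    simp only [ContinuousLinearMap.comp_apply]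
    rw [dHyp_tproj (hV.clm_apply htz) ι hv, dHyp_clm_apply hV htz,
      dHyp_tproj (diffAtHyp_const z) ι hv, dHyp_const, map_zero, zero_add]
  rw [bracket_swap, sub_neg_eq_add, hX.bracket_transl, nablaE, dHyp_clm_apply hV hco, hd]
  have e1 : ∀ {X : EndM n}, IsSkew X → lor n (ι p.1) (X (ι p.1)) = 0 := fun {X} h => by
    have := h (ι p.1) (ι p.1)
    rw [lor_comm] at this
    linarith
  have e2 : lor n (ι v) (V p (ι p.1)) = -lor n (ι p.1) (V p (ι v)) := by
    rw [lor_comm, hX]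
  ext z : 1
  simp only [add_apply, ContinuousLinearMap.comp_apply, hW, transl_apply, tproj_apply, map_add,
    map_smul, hX (ι p.1) z, hY (ι p.1) z, hX (ι v) z, e1 hX, e1 hY, e2, hPP, hPv, hvP, smul_eq_mul,
    LinearMap.add_apply, LinearMap.smul_apply]
  module

/-- `(∇_v α)(w) = (D_v α)(w) - [E_v, α(w)]`. -/
theorem nablaForm_eq (hι : ∀ x y, lor n (ι x) (ι y) = lor k x y)
    {α : Hyp k → Mink k →L[ℝ] EndM n} (hα : DiffAtHyp α p) (hs : ∀ y w, IsSkew (α y w))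
    (hn : ∀ y : Hyp k, α y y.1 = 0) {v w : Mink k} (hv : lor k p.1 v = 0)
    (hw : lor k p.1 w = 0) :
    nablaForm ι α p v w = dHyp α p v w - ⁅transl (ι p.1) (ι v), α p w⁆ := by
  have ht : DiffAtHyp (fun y : Hyp k => tproj y.1 w) p :=
    (diffAtHyp_const w).tproj (ContinuousLinearMap.id ℝ (Mink k))
  have h1 : ∀ z, α p (tproj p.1 z) = α p z := fun z => by
    rw [tproj_apply, map_add, map_smul, hn, smul_zero, add_zero]
  rw [nablaForm, nablaE_eq hι (hα.clm_apply ht) (fun y => hs y _) hv,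
    dHyp_clm_apply hα ht, h1, h1, tproj_tangent hw]
  abel

/-- The `ad` term of the connection contributes a second copy of `T*`, leaving the flat divergence
as the only differential term. -/
theorem Dstar_eq (hι : ∀ x y, lor n (ι x) (ι y) = lor k x y)
    {α : Hyp k → Mink k →L[ℝ] EndM n} (hα : DiffAtHyp α p) (hs : ∀ y w, IsSkew (α y w))
    (hn : ∀ y : Hyp k, α y y.1 = 0) {e : Fin k → Mink k} (he : IsFrameAt p e) :
    Dstar ι α p e = Tstar ι α p e - ∑ j, dHyp α p (e j) (e j) := by
  rw [Dstar, Tstar, Finset.sum_congr rfl fun j _ =>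
    nablaForm_eq hι hα hs hn (he.1 j) (he.1 j), Finset.sum_sub_distrib]
  abel

end

/-! ### The pullback under the orthogonal projection -/

section

variable {m : ℕ}

theorem trunc_eq_smul_orthProj (p : Hyp (m + 1)) :
    trunc m p.1 = mlen (trunc m p.1) • (orthProj p).1 := by
  have hc := trunc_mem_cone p.2
  rw [orthProj, retr_coe hc, smul_smul, mul_inv_cancel₀ (mlen_pos hc).ne', one_smul]

theorem orthProj_retr {z : Mink (m + 1)} (hz : z ∈ cone (m + 1)) :
    orthProj (retr z) = retr (trunc m z) := by
  rw [orthProj, retr_coe hz, map_smul,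
    retr_smul (inv_pos.2 (mlen_pos hz)) (trunc_mem_cone_of_mem hz)]

theorem hasFDerivAt_inv_mlen_trunc (p : Hyp (m + 1)) :
    HasFDerivAt (fun z : Mink (m + 1) => (mlen (trunc m z))⁻¹)
      (((mlen (trunc m p.1))⁻¹ ^ 3 • flatL m (trunc m p.1)) ∘L trunc m) p.1 :=
  (hasFDerivAt_inv_mlen (trunc_mem_cone p.2)).comp p.1 (trunc m).hasFDerivAt

/-- The derivative of the normalizing factor of `π` is radial, and `B` vanishes on the radial
direction. -/
theorem pullProj_eq {B : Hyp m → Mink m →L[ℝ] F} (hn : ∀ x : Hyp m, B x x.1 = 0)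
    (p : Hyp (m + 1)) :
    pullProj B p = (mlen (trunc m p.1))⁻¹ • (B (orthProj p) ∘L trunc m) := by
  have h1 := ((hasFDerivAt_inv_mlen_trunc p).fun_smul
    (trunc m).hasFDerivAt).congr_of_eventuallyEq (f₁ := fun z => (orthProj (retr z)).1) (by
      filter_upwards [cone_mem_nhds p] with z hz
      rw [orthProj_retr hz, retr_coe (trunc_mem_cone_of_mem hz)])
  have h2 : B (orthProj p) (trunc m p.1) = 0 := by
    rw [trunc_eq_smul_orthProj, map_smul, hn, smul_zero]
  rw [pullProj, dHyp, h1.fderiv]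
  ext v
  simp [h2]

theorem pullProj_retr {B : Hyp m → Mink m →L[ℝ] F} (hn : ∀ x : Hyp m, B x x.1 = 0)
    {z : Mink (m + 1)} (hz : z ∈ cone (m + 1)) :
    pullProj B (retr z) =
      (mlen z * (mlen (trunc m z))⁻¹) • (B (retr (trunc m z)) ∘L trunc m) := by
  rw [pullProj_eq hn, orthProj_retr hz, retr_coe hz, map_smul, mlen_smul (inv_pos.2 (mlen_pos hz)),
    mul_inv, inv_inv]

theorem smoothOnHyp_pullProj {B : Hyp m → Mink m →L[ℝ] F} (hs : SmoothOnHyp B)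
    (hn : ∀ x : Hyp m, B x x.1 = 0) : SmoothOnHyp (pullProj B) := by
  have ht : Set.MapsTo (trunc m) (cone (m + 1)) (cone m) := fun _ => trunc_mem_cone_of_mem
  have h1 : ContDiffOn ℝ ∞ (fun z => mlen z * (mlen (trunc m z))⁻¹) (cone (m + 1)) :=
    (contDiffOn_mlen _).mul (((contDiffOn_mlen m).comp (trunc m).contDiff.contDiffOn ht).inv
      fun z hz => (mlen_pos (ht hz)).ne')
  have h2 : ContDiffOn ℝ ∞ (fun z => B (retr (trunc m z))) (cone (m + 1)) :=
    ContDiffOn.comp (g := fun y => B (retr y)) hs (trunc m).contDiff.contDiffOn ht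
  exact (h1.smul (h2.clm_comp contDiffOn_const)).congr fun z hz => pullProj_retr hn hz

/-- One factor `sech r` comes from `pullProj_eq`, the other from differentiating at `trunc p = cosh
r • x`. The term without derivatives of `B` appears because `trunc v` need not be tangent at `x`. -/
theorem dHyp_pullProj {B : Hyp m → Mink m →L[ℝ] F} (hs : SmoothOnHyp B)
    (hn : ∀ x : Hyp m, B x x.1 = 0) (p : Hyp (m + 1)) {v : Mink (m + 1)}
    (hv : lor (m + 1) p.1 v = 0) (w : Mink (m + 1)) :
    dHyp (pullProj B) p v w = (mlen (trunc m p.1))⁻¹ ^ 2 •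
      (lor m (orthProj p).1 (trunc m v) • B (orthProj p) (trunc m w) +
        dHyp B (orthProj p) (trunc m v) (trunc m w)) := by
  have hc := mlen_pos (trunc_mem_cone p.2)
  have h1 : HasFDerivAt (fun z => mlen z * (mlen (trunc m z))⁻¹) _ p.1 :=
    (hasFDerivAt_mlen (coe_mem_cone p)).mul (hasFDerivAt_inv_mlen_trunc p)
  have h2 := hasFDerivAt_retr_smul hs (orthProj p) hc
  rw [← trunc_eq_smul_orthProj] at h2
  have h3 : HasFDerivAt (fun z => B (retr (trunc m z))) _ p.1 :=
    h2.comp p.1 (trunc m).hasFDerivAt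
  have h4 := (h1.fun_smul (h3.clm_comp (hasFDerivAt_const (trunc m) p.1))).congr_of_eventuallyEq
    (f₁ := fun z => pullProj B (retr z)) (by
      filter_upwards [cone_mem_nhds p] with z hz
      exact pullProj_retr hn hz)
  have h5 : retr (trunc m p.1) = orthProj p := rfl
  have h6 : lor m (trunc m p.1) (trunc m v) =
      mlen (trunc m p.1) * lor m (orthProj p).1 (trunc m v) := by
    conv_lhs => rw [trunc_eq_smul_orthProj]
    simp
  rw [dHyp, h4.fderiv, h5]
  simp only [add_apply, smul_apply, ContinuousLinearMap.comp_apply, mlen_coe,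
    ContinuousLinearMap.smulRight_apply, flatL_apply, hv, h6, ContinuousLinearMap.compL_apply,
    ContinuousLinearMap.flip_apply, zero_apply, map_zero, smul_eq_mul]
  match_scalars
  · field_simp
  · field_simp
    ring

/-- The derivative of a form vanishing on the radial direction, evaluated there. -/
theorem dHyp_apply_coe {α : Hyp m → Mink m →L[ℝ] F} {x : Hyp m} (hα : DiffAtHyp α x)
    (hn : ∀ x : Hyp m, α x x.1 = 0) (u : Mink m) : dHyp α x u x.1 = -α x u := by
  have h1 := dHyp_clm_apply hα (diffAtHyp_coe x) u
  simp only [hn, dHyp_const, dHyp_coe, tproj_apply, map_add, map_smul, smul_zero, add_zero] at h1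
  exact eq_neg_of_add_eq_zero_left h1.symm

/-- Projecting arbitrary `u, w` to the tangent space and expanding gives symmetry of exactly the
expression in `dHyp_pullProj`. -/
theorem IsClosedForm.symm {α : Hyp m → Mink m →L[ℝ] F} (hc : IsClosedForm α) {x : Hyp m}
    (hα : DiffAtHyp α x) (hn : ∀ x : Hyp m, α x x.1 = 0) (u w : Mink m) :
    lor m x.1 u • α x w + dHyp α x u w = lor m x.1 w • α x u + dHyp α x w u := by
  have h1 := hc x (tproj x.1 u) (tproj x.1 w) (lor_tproj x.2.1 u) (lor_tproj x.2.1 w)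
  simp only [tproj_apply, map_add, map_smul, dHyp_self hα,
    dHyp_apply_coe hα hn, smul_zero, add_zero] at h1
  rw [← sub_eq_zero, ← h1]
  module

theorem isClosedForm_pullProj {B : Hyp m → Mink m →L[ℝ] F} (hs : SmoothOnHyp B)
    (hn : ∀ x : Hyp m, B x x.1 = 0) (hc : IsClosedForm B) : IsClosedForm (pullProj B) := by
  intro p v w hv hw
  rw [dHyp_pullProj hs hn p hv, dHyp_pullProj hs hn p hw, hc.symm (hs.diffAtHyp _) hn, sub_self]

/-! ### Traces over frames of the hyperplane and of the ambient space -/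

/-- Both sums are compared with Lorentz traces, which differ by the normal direction. In the
applications the three extra terms vanish. -/
theorem sum_frame_succ {p : Hyp (m + 1)} {x : Hyp m} {e : Fin (m + 1) → Mink (m + 1)}
    {f : Fin m → Mink m} (he : IsFrameAt p e) (hf : IsFrameAt x f)
    (Φ : Mink (m + 1) →ₗ[ℝ] Mink (m + 1) →ₗ[ℝ] F) :
    ∑ k, Φ (e k) (e k) = ∑ j, Φ (incl m (f j)) (incl m (f j)) + Φ p.1 p.1 + Φ (nrm m) (nrm m) -
      Φ (incl m x.1) (incl m x.1) := by
  have h := hf.sum_eq (Φ.compl₁₂ (incl m : Mink m →ₗ[ℝ] _) (incl m : Mink m →ₗ[ℝ] _))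
  simp only [LinearMap.compl₁₂_apply, ContinuousLinearMap.coe_coe] at h
  rw [he.sum_eq, lorTrace_succ, h]
  abel

theorem sum_dHyp_pullProj {B : Hyp m → Mink m →L[ℝ] F} (hs : SmoothOnHyp B)
    (hn : ∀ x : Hyp m, B x x.1 = 0)
    (hB : ∀ x f, IsFrameAt x f → ∑ j, dHyp B x (f j) (f j) = 0) {p : Hyp (m + 1)}
    {e : Fin (m + 1) → Mink (m + 1)} (he : IsFrameAt p e) :
    ∑ j, dHyp (pullProj B) p (e j) (e j) = 0 := by
  obtain ⟨f, hf⟩ := exists_isFrameAt (orthProj p)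
  have hd := hs.diffAtHyp (orthProj p)
  let Φ : Mink (m + 1) →ₗ[ℝ] Mink (m + 1) →ₗ[ℝ] F := LinearMap.mk₂ ℝ
    (fun v w => lor m (orthProj p).1 (trunc m v) • B (orthProj p) (trunc m w) +
      dHyp B (orthProj p) (trunc m v) (trunc m w))
    (fun v v' w => by simp only [map_add, add_apply]; module)
    (fun c v w => by simp only [map_smul, smul_apply, smul_eq_mul]; module)
    (fun v w w' => by simp only [map_add]; module)
    (fun c v w => by simp only [map_smul]; module)
  have hΦ : ∀ v w, Φ v w = lor m (orthProj p).1 (trunc m v) • B (orthProj p) (trunc m w) +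
      dHyp B (orthProj p) (trunc m v) (trunc m w) := fun _ _ => rfl
  have h1 := sum_frame_succ he hf Φ
  have hp : Φ p.1 p.1 = 0 := by
    rw [hΦ, trunc_eq_smul_orthProj]
    simp [hn, dHyp_self hd]
  have hx : Φ (incl m (orthProj p).1) (incl m (orthProj p).1) = 0 := by
    rw [hΦ, trunc_incl]
    simp [hn, dHyp_self hd]
  have hN : Φ (nrm m) (nrm m) = 0 := by
    rw [hΦ, trunc_nrm]
    simp
  have hsum : ∑ j, Φ (incl m (f j)) (incl m (f j)) = 0 := by
    simp only [hΦ, trunc_incl, hf.1, zero_smul, zero_add]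
    exact hB _ f hf
  rw [Finset.sum_congr rfl fun j _ => dHyp_pullProj hs hn p (he.1 j) (e j), ← Finset.smul_sum]
  change _ • ∑ j, Φ (e j) (e j) = 0
  rw [h1, hp, hx, hN, hsum]
  simp

/-! ### The algebraic part of the codifferential -/

/-- The commutator as a bilinear map. -/
def brL (n : ℕ) : EndM n →ₗ[ℝ] EndM n →ₗ[ℝ] EndM n :=
  LinearMap.mk₂ ℝ (fun X Y => X * Y - Y * X)
    (fun X X' Y => by rw [add_mul, mul_add]; abel)
    (fun c X Y => by rw [smul_mul_assoc, mul_smul_comm, smul_sub])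
    (fun X Y Y' => by rw [add_mul, mul_add]; abel)
    (fun c X Y => by rw [smul_mul_assoc, mul_smul_comm, smul_sub])

theorem brL_apply {n : ℕ} (X Y : EndM n) : brL n X Y = ⁅X, Y⁆ := rfl

/-- `transl` as a linear map in the direction. -/
def translL {n : ℕ} (p : Mink n) : Mink n →ₗ[ℝ] EndM n where
  toFun := transl p
  map_add' := transl_add_right p
  map_smul' c := transl_smul_right c p

theorem tensorSum_apply {k n : ℕ} (b : Matrix (Fin m) (Fin m) ℝ) (S : Fin m → EndM n)
    (θ : Fin m → Mink k →L[ℝ] ℝ) (w : Mink k) :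
    tensorSum b S θ w = ∑ i, ∑ j, (b i j * θ j w) • S i := by
  simp [tensorSum, sum_apply, smul_smul]

theorem rot_nrm_incl {x : Hyp m} {v : Mink m} (hv : lor m x.1 v = 0) :
    rot (incl m x.1) (nrm m) (incl m v) = transl (nrm m) (incl m v) :=
  rot_eq_transl (by rw [lor_incl_incl, x.2.1]) (by rw [lor_incl, trunc_nrm, map_zero])
    (by rw [lor_incl_incl, hv])

/-- If `b` is symmetric and traceless, then `∑ⱼ [Eⱼ, ∑ᵢ bᵢⱼ R_{ni}] = 0` for the infinitesimal
translations `Eⱼ` at any point over `x`. -/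
theorem sum_bracket_eq_zero {x : Hyp m} {f : Fin m → Mink m} (hf : IsFrameAt x f)
    {b : Matrix (Fin m) (Fin m) ℝ} (hsym : b.IsSymm) (htr : b.trace = 0) {q : Mink (m + 1)}
    (hq : ∀ j, lor (m + 1) q (incl m (f j)) = 0) :
    ∑ j, ⁅transl q (incl m (f j)),
      tensorSum b (fun i => rot (incl m x.1) (nrm m) (incl m (f i))) (fun j => flat (f j)) (f j)⁆ =
      0 := by
  have h1 : ∀ i j, ⁅transl q (incl m (f j)), transl (nrm m) (incl m (f i))⁆ =
      (if i = j then 1 else 0 : ℝ) • transl (nrm m) q -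
        lor (m + 1) q (nrm m) • transl (incl m (f j)) (incl m (f i)) := by
    intro i j
    have hN : lor (m + 1) (incl m (f j)) (nrm m) = 0 := by rw [lor_incl, trunc_nrm, map_zero]
    rw [(isSkew_transl _ _).bracket_transl, transl_apply, transl_apply, hq i, hN, lor_incl_incl,
      hf.2]
    simp only [zero_smul, zero_sub, sub_zero, eq_comm (a := j), ← neg_smul, transl_smul_left,
      transl_smul_right]
    module
  -- A symmetric matrix is paired with an antisymmetric family, so the sum equals its own negative.
  have h2 : ∑ i, ∑ j, b i j • transl (incl m (f j)) (incl m (f i)) = 0 := by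
    suffices h : (2 : ℝ) • ∑ i, ∑ j, b i j • transl (incl m (f j)) (incl m (f i)) = 0 by
      simpa using h
    rw [two_smul, ← eq_neg_iff_add_eq_zero]
    nth_rewrite 1 [Finset.sum_comm]
    simp only [← Finset.sum_neg_distrib]
    refine Finset.sum_congr rfl fun i _ => Finset.sum_congr rfl fun j _ => ?_
    rw [hsym.apply, transl_swap]
    module
  have h3 : ∀ j, tensorSum b (fun i => rot (incl m x.1) (nrm m) (incl m (f i)))
      (fun j => flat (f j)) (f j) = ∑ i, b i j • transl (nrm m) (incl m (f i)) := fun j => by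
    simp [tensorSum_apply, flat_apply, hf.2, rot_nrm_incl (hf.1 _)]
  simp only [h3, ← brL_apply, map_sum, map_smul]
  simp only [brL_apply, h1, smul_sub, Finset.sum_sub_distrib]
  rw [Finset.sum_comm]
  simp only [smul_comm (b _ _) (lor (m + 1) q (nrm m)), ← Finset.smul_sum]
  rw [Finset.sum_comm (f := fun j i => b i j • transl (incl m (f j)) (incl m (f i))), h2]
  have h4 : ∑ i, ∑ j, b i j • (if i = j then 1 else 0 : ℝ) • transl (nrm m) q =
      b.trace • transl (nrm m) q := by
    simp [Matrix.trace, Finset.sum_smul]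
  rw [h4, htr, zero_smul, smul_zero, sub_zero]

theorem Tstar_pullProj {B : Hyp m → Mink m →L[ℝ] EndM (m + 1)}
    (hn : ∀ x : Hyp m, B x x.1 = 0)
    (hB : ∀ x : Hyp m, ∃ (e : Fin m → Mink m) (b : Matrix (Fin m) (Fin m) ℝ),
      IsFrameAt x e ∧ b.IsSymm ∧ b.trace = 0 ∧
      B x = tensorSum b (fun i => rot (incl m x.1) (nrm m) (incl m (e i)))
        (fun j => flat (e j))) {p : Hyp (m + 1)} {e : Fin (m + 1) → Mink (m + 1)}
    (he : IsFrameAt p e) :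
    Tstar (ContinuousLinearMap.id ℝ _) (pullProj B) p e = 0 := by
  obtain ⟨f, b, hf, hsym, htr, hb⟩ := hB (orthProj p)
  let Φ : Mink (m + 1) →ₗ[ℝ] Mink (m + 1) →ₗ[ℝ] EndM (m + 1) :=
    (brL (m + 1)).compl₁₂ (translL p.1) (pullProj B p : Mink (m + 1) →ₗ[ℝ] EndM (m + 1))
  have hΦ : ∀ v w, Φ v w = ⁅transl p.1 v, pullProj B p w⁆ := fun _ _ => rfl
  have hw : ∀ w, pullProj B p w = (mlen (trunc m p.1))⁻¹ • B (orthProj p) (trunc m w) := fun w => by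
    rw [pullProj_eq hn]
    rfl
  have hp : Φ p.1 p.1 = 0 := by
    rw [hΦ, transl_self, ← brL_apply, map_zero, LinearMap.zero_apply]
  have hx : Φ (incl m (orthProj p).1) (incl m (orthProj p).1) = 0 := by
    rw [hΦ, hw, trunc_incl, hn, smul_zero, ← brL_apply, map_zero]
  have hN : Φ (nrm m) (nrm m) = 0 := by
    rw [hΦ, hw, trunc_nrm, map_zero, smul_zero, ← brL_apply, map_zero]
  have hsum : ∑ j, Φ (incl m (f j)) (incl m (f j)) = 0 := by
    simp only [hΦ, hw, trunc_incl, ← brL_apply, map_smul]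
    rw [← Finset.smul_sum, hb]
    simp only [brL_apply]
    rw [sum_bracket_eq_zero hf hsym htr, smul_zero]
    -- Here `trunc p` is a multiple of `x`, so the horizontal frame vectors are orthogonal to `p` as
    -- well.
    intro j
    rw [lor_comm, lor_incl, trunc_eq_smul_orthProj, map_smul, lor_comm, hf.1, smul_zero]
  change ∑ j, Φ (e j) (e j) = 0
  rw [sum_frame_succ he hf, hp, hx, hN, hsum]
  simp

theorem Tstar_incl {B : Hyp m → Mink m →L[ℝ] EndM (m + 1)}
    (hB : ∀ x : Hyp m, ∃ (e : Fin m → Mink m) (b : Matrix (Fin m) (Fin m) ℝ),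
      IsFrameAt x e ∧ b.IsSymm ∧ b.trace = 0 ∧
      B x = tensorSum b (fun i => rot (incl m x.1) (nrm m) (incl m (e i)))
        (fun j => flat (e j))) {x : Hyp m} {e : Fin m → Mink m}
    (he : IsFrameAt x e) :
    Tstar (incl m) B x e = 0 := by
  obtain ⟨f, b, hf, hsym, htr, hb⟩ := hB x
  let Φ : Mink m →ₗ[ℝ] Mink m →ₗ[ℝ] EndM (m + 1) :=
    (brL (m + 1)).compl₁₂ (translL (incl m x.1) ∘ₗ (incl m : Mink m →ₗ[ℝ] Mink (m + 1)))
      (B x : Mink m →ₗ[ℝ] EndM (m + 1))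
  change ∑ j, Φ (e j) (e j) = 0
  -- The given frame is exchanged for the one in which `B` has its symmetric traceless expression.
  rw [he.sum_eq, ← hf.sum_eq]
  change ∑ j, ⁅transl (incl m x.1) (incl m (f j)), B x (f j)⁆ = 0
  rw [hb]
  exact sum_bracket_eq_zero hf hsym htr fun j => by rw [lor_incl_incl, hf.1]

/-! ### The form in the extended frame -/

theorem trunc_fermi (x : Hyp m) (r : ℝ) : trunc m (fermi x r).1 = Real.cosh r • x.1 := by
  rw [fermi, map_add, map_smul, map_smul, trunc_incl, trunc_nrm, smul_zero, add_zero]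

theorem extVec_eq {x : Hyp m} {v : Mink m} (hv : lor m x.1 v = 0) (r : ℝ) :
    extVec x r v = incl m v := by
  have h := (diffAtHyp_coe x).clm (Real.cosh r • incl m)
  have h1 : dHyp (fun y : Hyp m => (fermi y r).1) x v = Real.cosh r • incl m v := by
    change dHyp (fun y : Hyp m => (Real.cosh r • incl m) y.1 + Real.sinh r • nrm m) x v = _
    rw [dHyp_add h (diffAtHyp_const _), dHyp_const, add_zero, dHyp_clm _ (diffAtHyp_coe x),
      dHyp_coe, tproj_tangent hv]
    rfl
  rw [extVec, h1, smul_smul, inv_mul_cancel₀ (Real.cosh_pos r).ne', one_smul]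

theorem rot_fermi {x : Hyp m} {v : Mink m} (hv : lor m x.1 v = 0) (r : ℝ) :
    rot (fermi x r).1 (nrmAt x r) (incl m v) -
      Real.tanh r • transl (fermi x r).1 (incl m v) =
      (Real.cosh r)⁻¹ • transl (nrm m) (incl m v) := by
  have hc := (Real.cosh_pos r).ne'
  -- The coefficient `tanh r` is the one that cancels the component along the hyperplane; `cosh² -
  -- sinh² = 1` leaves `sech r`.
  have hN : nrmAt x r - Real.tanh r • (fermi x r).1 = (Real.cosh r)⁻¹ • nrm m := by
    rw [nrmAt, fermi, Real.tanh_eq_sinh_div_cosh]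
    have := Real.cosh_sq r
    match_scalars
    · field_simp
      ring
    · field_simp
      linarith
  have h1 : lor (m + 1) (fermi x r).1 (nrmAt x r) = 0 := by
    simp only [fermi, nrmAt, map_add, map_smul, LinearMap.add_apply, LinearMap.smul_apply,
      lor_incl, trunc_incl, x.2.1, lor_nrm, trunc_nrm, incl_last, nrm_last, smul_eq_mul,
      map_zero]
    ring
  have h2 : lor (m + 1) (fermi x r).1 (incl m v) = 0 := by
    rw [lor_comm, lor_incl, trunc_fermi, map_smul, lor_comm, hv, smul_zero]
  rw [rot_eq_transl (fermi x r).2.1 h1 h2, ← transl_smul_left (Real.cosh r)⁻¹, ← hN,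
    sub_eq_add_neg (nrmAt x r), transl_add_left, ← neg_smul, transl_smul_left]
  module

theorem pullProj_fermi {B : Hyp m → Mink m →L[ℝ] EndM (m + 1)} (hn : ∀ x : Hyp m, B x x.1 = 0)
    {x : Hyp m} (r : ℝ) {e : Fin m → Mink m} {b : Matrix (Fin m) (Fin m) ℝ} (he : IsFrameAt x e)
    (hb : B x = tensorSum b (fun i => rot (incl m x.1) (nrm m) (incl m (e i)))
      (fun j => flat (e j))) :
    pullProj B (fermi x r) =
      tensorSum b (fun i => rot (fermi x r).1 (nrmAt x r) (extVec x r (e i)))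
        (fun j => flat (extVec x r (e j))) -
      Real.tanh r • tensorSum b (fun i => transl (fermi x r).1 (extVec x r (e i)))
        (fun j => flat (extVec x r (e j))) := by
  ext w : 1
  rw [pullProj_eq hn, orthProj_fermi, hb, trunc_fermi, mlen_smul (Real.cosh_pos r), mlen_coe,
    mul_one]
  simp only [smul_apply, sub_apply, ContinuousLinearMap.comp_apply, tensorSum_apply,
    extVec_eq (he.1 _), rot_nrm_incl (he.1 _), flat_apply, lor_incl, Finset.smul_sum,
    ← Finset.sum_sub_distrib]
  refine Finset.sum_congr rfl fun i _ => Finset.sum_congr rfl fun j _ => ?_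
  rw [smul_comm, ← rot_fermi (he.1 i), smul_sub, smul_comm (Real.tanh r)]

/-! ### Invariance -/

theorem trunc_extIsom (g : Isom m) (z : Mink (m + 1)) :
    trunc m ((extIsom m g).1 z) = g.1 (trunc m z) :=
  trunc_extLin _ _

theorem orthProj_extIsom (g : Isom m) (p : Hyp (m + 1)) :
    orthProj (extIsom m g • p) = g • orthProj p := by
  have h : trunc m (extIsom m g • p).1 = g.1 (trunc m p.1) := trunc_extIsom g p.1
  have h2 : mlen (trunc m (extIsom m g • p).1) = mlen (trunc m p.1) := by
    rw [h, mlen, mlen, g.2.1]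
  apply Subtype.ext
  change _ = g.1 (orthProj p).1
  rw [orthProj, orthProj, retr_coe (trunc_mem_cone (extIsom m g • p).2), h2, h,
    retr_coe (trunc_mem_cone p.2), map_smul]

/-- The pullback of a form on `Hyp m / Γ` to the associated Fuchsian manifold. -/
def pullForm {Γ : Subgroup (Isom m)} (B : EForm m (m + 1) Γ (extIsom m)) :
    EForm (m + 1) (m + 1) (Γ.map (extIsom m)) (MonoidHom.id _) where
  toFun := pullProj B
  skew' p v := by
    rw [pullProj_eq B.normal', ← isSkew_iff]
    exact (isSkew_iff.2 (B.skew' _ _)).smul _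
  normal' p := by
    rw [pullProj_eq B.normal', smul_apply, ContinuousLinearMap.comp_apply,
      trunc_eq_smul_orthProj, map_smul, B.normal', smul_zero, smul_zero]
  smooth' := smoothOnHyp_pullProj B.smooth' B.normal'
  invariant' := by
    rintro _ ⟨g, hg, rfl⟩ p v
    have h : trunc m (extIsom m g • p).1 = g.1 (trunc m p.1) := trunc_extIsom g p.1
    rw [pullProj_eq B.normal', pullProj_eq B.normal', orthProj_extIsom, h, mlen, g.2.1, ← mlen]
    simp only [smul_apply, ContinuousLinearMap.comp_apply, trunc_extIsom, MonoidHom.id_apply]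
    rw [B.invariant' g hg, ContinuousLinearMap.smul_comp, ContinuousLinearMap.comp_smul]

end

end Fuchsian

end

/-! ### The pulled-back form and its codifferential -/

open Fuchsian in
theorem mainTheorem6 (m : ℕ) (hm : 2 ≤ m)
    (Γ : Subgroup (Isom m)) (hΓ : IsManifoldGroup Γ)
    (B : EForm m (m + 1) Γ (extIsom m))
    (hclosed : IsClosedForm B)
    (hcoclosed : IsCoclosedForm (incl m) B)
    (hB : ∀ x : Hyp m, ∃ (e : Fin m → Mink m) (b : Matrix (Fin m) (Fin m) ℝ),
      IsFrameAt x e ∧ b.IsSymm ∧ b.trace = 0 ∧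
      B x = tensorSum b (fun i => rot (incl m x.1) (nrm m) (incl m (e i)))
        (fun j => flat (e j))) :
    ∃ ω₀ : EForm (m + 1) (m + 1) (Γ.map (extIsom m)) (MonoidHom.id _),
      (∀ (x : Hyp m) (r : ℝ) (e : Fin m → Mink m) (b : Matrix (Fin m) (Fin m) ℝ),
        IsFrameAt x e →
        B x = tensorSum b (fun i => rot (incl m x.1) (nrm m) (incl m (e i)))
          (fun j => flat (e j)) →
        ω₀ (fermi x r) =
          tensorSum b (fun i => rot (fermi x r).1 (nrmAt x r) (extVec x r (e i)))
            (fun j => flat (extVec x r (e j))) -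
          Real.tanh r • tensorSum b (fun i => transl (fermi x r).1 (extVec x r (e i)))
            (fun j => flat (extVec x r (e j)))) ∧
      (∀ p, ω₀ p = pullProj B p) ∧
      IsClosedForm ω₀ ∧
      IsCoclosedForm (ContinuousLinearMap.id ℝ _) ω₀ ∧
      (∀ p e, IsFrameAt p e → Dstar (ContinuousLinearMap.id ℝ _) ω₀ p e = 0) := by
  -- As `T* B = 0`, co-closedness of `B` reduces to vanishing flat divergence.
  have hdiv : ∀ x f, IsFrameAt x f → ∑ j, dHyp B x (f j) (f j) = 0 := fun x f hf => by
    have h := hcoclosed x f hf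
    rw [Dstar_eq lor_incl_incl (B.smooth'.diffAtHyp x) (fun y w => isSkew_iff.2 (B.skew' y w))
      B.normal' hf, Tstar_incl hB hf] at h
    simpa using h
  have hD : ∀ p e, IsFrameAt p e →
      Dstar (ContinuousLinearMap.id ℝ _) (pullForm B) p e = 0 := fun p e he => by
    rw [Dstar_eq (fun _ _ => rfl) ((pullForm B).smooth'.diffAtHyp p)
      (fun y w => isSkew_iff.2 ((pullForm B).skew' y w)) (pullForm B).normal' he]
    change Tstar _ (pullProj B) p e - ∑ j, dHyp (pullProj B) p (e j) (e j) = 0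
    rw [Tstar_pullProj B.normal' hB he, sum_dHyp_pullProj B.smooth' B.normal' hdiv he, sub_zero]
  refine ⟨pullForm B, fun x r e b he hb => pullProj_fermi B.normal' r he hb, fun _ => rfl,
    isClosedForm_pullProj B.smooth' B.normal' hclosed, fun p e he => ?_, hD⟩
  rw [hD p e he, zero_add]
  exact Tstar_pullProj B.normal' hB he
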